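/- Fix $n$, let $U=\mathbb{Z}^n$ and let $\mathcal{K}^\star$ be the family of all convex subsets of $\mathbb{R}^n$. A *halfspace* is a set $H\in\mathcal{K}^\star$ with $\mathbb{R}^n\setminus H\in\mathcal{K}^\star$; it is *valid* for a set $X\subseteq\mathbb{Z}^n$ if $X\subseteq H$. A *valid disjunction* is a finite family $K_1,\dots,K_p\in\mathcal{K}^\star$ with $\mathbb{Z}^n\subseteq K_1\cup\dots\cup K_p$. A *branch-and-cut tree* is a rooted tree in which every node carries a finite list $\mathcal{L}$ of sets in $\mathcal{K}^\star$; the intersection $\bigcap\mathcal{L}$ is the set corresponding to the node. Every internal node carries either a valid disjunction $K_1,\dots,K_p$, and then it has $p$ children with lists $\mathcal{L}\cup\{K_i\}$; or a halfspace $H$ valid for $\bigcap\mathcal{L}\cap\mathbb{Z}^n$, and then it has one child with list $\mathcal{L}\cup\{H\}$ and one leaf, called a cutting plane certifier, that holds a certificate that no point of $\bigcap\mathcal{L}\cap\mathbb{Z}^n$ lies outside $H$. Such a certificate is either a branch-and-cut tree whose root has list $\mathcal{L}\cup\{G\}$, where $G\in\mathcal{K}^\star$ and $G\cap\mathbb{Z}^n=\mathbb{Z}^n\setminus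 H$, and all of whose leaves other than cutting plane certifiers correspond to the empty set (its size is the size of that tree), or any other kind of certificate from a fixed arbitrary collection, of size at least $1$. The *size* of a tree is its number of nodes, where each cutting plane certifier is counted with the size of its certificate (instead of as one node). The trees are relative to an arbitrary fixed choice of which disjunctions, which halfspaces (depending on the list at the node; the *cutting plane paradigm*) and which other certificates may be used. A *pure cutting plane proof* is a branch-and-cut tree without disjunctions; the certificates inside its cutting plane certifiers may contain disjunctions. Let $K'_1,\dots,K'_t\in\mathcal{K}^\star$ be such that $P'=K'_1\cap\dots\cap K'_t$ is a polyhedron, let $P=P'\cap\mathbb{Z}^n$ and $P_I=\operatorname{conv}(P)$. Below, all trees are pure cutting plane proofs whose root has list $K'_1,\dots,K'_t$, and "leaves" means leaves that are not cutting plane certifiers. The *membership complexity* of a point $x\notin P_I$ is the minimum size of a tree such that $x$ is not in the convex hull of the union of the sets corresponding to its leaves; the *membership complexity of $P$* is the maximum of this over all $x\in\mathbb{R}^n\setminus P_I$. The *validity complexity* of a halfspace $H$ is the minimum size of a tree such that the sets corresponding to its leaves are contained in $H$. The *facet complexity of $P$* is the maximum, over all facets $F$ of $P_I$, of the minimum validity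 complexity of the closed halfspaces $\{x:\langle a,x\rangle\le b\}\supseteq P_I$ with $a\neq 0$ and $F=P_I\cap\{x:\langle a,x\rangle=b\}$. (A minimum over no trees is $+\infty$; a maximum is a supremum in $\mathbb{N}\cup\{+\infty\}$, where $\mathbb{N}$ contains $0$, and is $0$ over the empty set.) **Theorem.** Suppose that $P'$ is a polyhedron whose recession cone is a rational polyhedral cone, that is, defined by finitely many homogeneous linear inequalities with rational coefficients (for example, $P'$ may be a rational polyhedron or any polytope), and that $P_I$ is a full-dimensional rational polytope. Suppose that the cutting plane paradigm can generate all Chvátal–Gomory cuts: whenever the set corresponding to a node is contained in a rational closed halfspace $H'$, the halfspace $\operatorname{conv}(H'\cap\mathbb{Z}^n)$ may be used at that node. Then $$\text{membership complexity of }P\;\le\;\text{facet complexity of }P\;\le\;\text{membership complexity of }P+2 .$$ -/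

import Mathlib

/-- The integer lattice `ℤⁿ` as a subset of `ℝⁿ`. -/
def intLattice (n : ℕ) : Set (Fin n → ℝ) := {x | ∀ i, ∃ z : ℤ, x i = z}

/-- The set corresponding to a label: the intersection of all sets in the list. -/
def labelSet {n : ℕ} (L : List (Set (Fin n → ℝ))) : Set (Fin n → ℝ) := {x | ∀ K ∈ L, x ∈ K}

/-- The closed halfspace `⟨a, x⟩ ≤ b`. -/
def closedHalfspace {n : ℕ} (a : Fin n → ℝ) (b : ℝ) : Set (Fin n → ℝ) := {x | a ⬝ᵥ x ≤ b}

/-- Halfspaces in the Helly system of all convex subsets of `ℝⁿ`: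
convex sets with convex complement. -/
def IsHellyHalfspace {n : ℕ} (H : Set (Fin n → ℝ)) : Prop := Convex ℝ H ∧ Convex ℝ Hᶜ

/-- Valid disjunctions: finitely many convex sets that together contain all integer points. -/
def IsValidDisjunction {n p : ℕ} (K : Fin p → Set (Fin n → ℝ)) : Prop :=
  (∀ i, Convex ℝ (K i)) ∧ intLattice n ⊆ ⋃ i, K i

/-- Valid halfspaces for the integer points of `labelSet L`. -/
def IsValidHalfspace {n : ℕ} (L : List (Set (Fin n → ℝ))) (H : Set (Fin n → ℝ)) : Prop :=
  IsHellyHalfspace H ∧ labelSet L ∩ intLattice n ⊆ H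

/-- The choices that branch-and-cut trees are relative to: a branching scheme (the disjunctions
that may be used), a cutting plane paradigm (the halfspaces that may be used at a node with a given
first label), and any further certificates of validity of a cutting plane besides branch-and-cut
certificates (for instance combinatorial ones), with their sizes: `otherCert L H k` says that there
is one of size `k` for the halfspace `H` at a node with first label `L`. None of the three has to be
sound here: soundness is demanded where they are used, in `BCTree.Valid`. -/
structure ProofSystem (n : ℕ) where
  branching : (p : ℕ) → (Fin p → Set (Fin n → ℝ)) → Prop
  cutting : List (Set (Fin n → ℝ)) → Set (Fin n → ℝ) → Prop
  otherCert : List (Set (Fin n → ℝ)) → Set (Fin n → ℝ) → ℕ → Prop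

/-- The shape of a branch-and-cut tree with the second labels of its nodes. First labels are
determined by the one at the root. `cut H G c T` is a node with halfspace `H`, right subtree `T`, and
a cutting plane certifier with the branch-and-cut certificate `c` that no integer point of the node
lies outside `H`, where `G` is the relaxation of the complement of `H` used in that certificate.
`cutOther H k T` is a node with halfspace `H` whose certifier holds another certificate,
of size `k`. -/
inductive BCTree (n : ℕ) : Type
  | leaf : BCTree n
  | branch (p : ℕ) (K : Fin p → Set (Fin n → ℝ)) (T : Fin p → BCTree n) : BCTree n
  | cut (H G : Set (Fin n → ℝ)) (c : BCTree n) (T : BCTree n) : BCTree n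
  | cutOther (H : Set (Fin n → ℝ)) (k : ℕ) (T : BCTree n) : BCTree n

namespace BCTree

/-- The size of a tree: the number of its nodes, where a cutting plane certifier counts with the
size of its certificate of infeasibility (so that one whose certificate is a single infeasible
leaf counts once). -/
def size {n : ℕ} : BCTree n → ℕ
  | leaf => 1
  | branch _ _ T => 1 + ∑ i, (T i).size
  | cut _ _ c T => 1 + c.size + T.size
  | cutOther _ k T => 1 + k + T.size

/-- The union, over all leaves that are not cutting plane certifiers, of the sets corresponding to
these leaves, when the root has first label `L`. -/
def leafUnion {n : ℕ} : BCTree n → List (Set (Fin n → ℝ)) → Set (Fin n → ℝ)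
  | leaf, L => labelSet L
  | branch _ K T, L => ⋃ i, (T i).leafUnion (K i :: L)
  | cut H _ _ T, L => T.leafUnion (H :: L)
  | cutOther H _ T, L => T.leafUnion (H :: L)

/-- `T.Valid S L`: `T` with first label `L` at its root is a branch-and-cut tree for `ℤⁿ ⊆ ℝⁿ` that
uses the disjunctions, halfspaces and certificates offered by `S`. A branch-and-cut certificate of
infeasibility is a tree whose leaves all have the empty set as corresponding set. -/
def Valid {n : ℕ} (S : ProofSystem n) : BCTree n → List (Set (Fin n → ℝ)) → Prop
  | leaf, _ => True
  | branch p K T, L =>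
      S.branching p K ∧ IsValidDisjunction K ∧ ∀ i, (T i).Valid S (K i :: L)
  | cut H G c T, L =>
      S.cutting L H ∧ IsValidHalfspace L H ∧
      (Convex ℝ G ∧ G ∩ intLattice n = intLattice n \ H) ∧
      (c.Valid S (G :: L) ∧ c.leafUnion (G :: L) = ∅) ∧
      T.Valid S (H :: L)
  | cutOther H k T, L =>
      S.cutting L H ∧ IsValidHalfspace L H ∧ (S.otherCert L H k ∧ 1 ≤ k) ∧ T.Valid S (H :: L)

/-- Pure cutting plane proofs: no disjunctions in the tree (the certificates of validity of the
cutting planes may contain disjunctions). -/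
def IsPureCut {n : ℕ} : BCTree n → Prop
  | leaf => True
  | branch _ _ _ => False
  | cut _ _ _ T => T.IsPureCut
  | cutOther _ _ T => T.IsPureCut

end BCTree

/-- `T` is a pure cutting plane proof in `S` with first label `L` at the root. -/
def IsCuttingPlaneProof {n : ℕ} (S : ProofSystem n) (L : List (Set (Fin n → ℝ)))
    (T : BCTree n) : Prop :=
  T.IsPureCut ∧ T.Valid S L

/-- The validity complexity of the halfspace `H` with respect to `L`, over pure cutting plane
proofs; `⊤` if there is no proof. -/
noncomputable def validityComplexity {n : ℕ} (S : ProofSystem n) (L : List (Set (Fin n → ℝ)))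
    (H : Set (Fin n → ℝ)) : ℕ∞ :=
  ⨅ (T : BCTree n) (_ : IsCuttingPlaneProof S L T ∧ T.leafUnion L ⊆ H), (T.size : ℕ∞)

/-- The membership complexity of the point `x` with respect to `L`, over pure cutting plane
proofs; `⊤` if there is no proof. -/
noncomputable def pointComplexity {n : ℕ} (S : ProofSystem n) (L : List (Set (Fin n → ℝ)))
    (x : Fin n → ℝ) : ℕ∞ :=
  ⨅ (T : BCTree n) (_ : IsCuttingPlaneProof S L T ∧ x ∉ convexHull ℝ (T.leafUnion L)),
    (T.size : ℕ∞)

/-- The integer hull: the convex hull of the integer points of `labelSet L`. -/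
def integerHull {n : ℕ} (L : List (Set (Fin n → ℝ))) : Set (Fin n → ℝ) :=
  convexHull ℝ (labelSet L ∩ intLattice n)

/-- The membership complexity of the set of integer points of `labelSet L`. -/
noncomputable def membershipComplexity {n : ℕ} (S : ProofSystem n)
    (L : List (Set (Fin n → ℝ))) : ℕ∞ :=
  ⨆ (x : Fin n → ℝ) (_ : x ∉ integerHull L), pointComplexity S L x

/-- The closed halfspace `H` is valid for `Q`, and its boundary hyperplane meets `Q` in `F`. -/
def DefinesFace {n : ℕ} (Q F H : Set (Fin n → ℝ)) : Prop :=
  ∃ (a : Fin n → ℝ) (b : ℝ), a ≠ 0 ∧ H = closedHalfspace a b ∧ Q ⊆ H ∧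
    F = Q ∩ {x | a ⬝ᵥ x = b}

/-- Facets: nonempty faces whose dimension is one less than that of `Q`. -/
def IsFacet {n : ℕ} (Q F : Set (Fin n → ℝ)) : Prop :=
  (∃ H, DefinesFace Q F H) ∧ F.Nonempty ∧
    Module.finrank ℝ (vectorSpan ℝ F) + 1 = Module.finrank ℝ (vectorSpan ℝ Q)

/-- The facet complexity: the maximum, over the facets of the integer hull, of the minimum of the
validity complexities of the halfspaces that define the facet. -/
noncomputable def facetComplexity {n : ℕ} (S : ProofSystem n)
    (L : List (Set (Fin n → ℝ))) : ℕ∞ :=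
  ⨆ (F : Set (Fin n → ℝ)) (_ : IsFacet (integerHull L) F),
    ⨅ (H : Set (Fin n → ℝ)) (_ : DefinesFace (integerHull L) F H), validityComplexity S L H

/-- Rational closed halfspaces. -/
def IsRationalClosedHalfspace {n : ℕ} (H : Set (Fin n → ℝ)) : Prop :=
  ∃ (a : Fin n → ℚ) (b : ℚ), a ≠ 0 ∧ H = closedHalfspace (fun i => (a i : ℝ)) (b : ℝ)

/-- The cutting plane paradigm contains all Chvátal–Gomory cuts: whenever the set corresponding to a
node lies in a rational closed halfspace `H'`, the smallest convex set that contains all integer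
points of `H'` may be used there. (If `H'` is `⟨a, x⟩ ≤ β` with `a` a primitive integer vector, then
this set is `⟨a, x⟩ ≤ ⌊β⌋`.) -/
def ProofSystem.GeneratesAllCGCuts {n : ℕ} (S : ProofSystem n) : Prop :=
  ∀ L : List (Set (Fin n → ℝ)), (∀ K ∈ L, Convex ℝ K) →
    ∀ H' : Set (Fin n → ℝ), IsRationalClosedHalfspace H' → labelSet L ⊆ H' →
      S.cutting L (convexHull ℝ (H' ∩ intLattice n))

/-- Polyhedra: intersections of finitely many closed halfspaces. -/
def IsPolyhedron {n : ℕ} (Q : Set (Fin n → ℝ)) : Prop :=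
  ∃ (m : ℕ) (A : Fin m → Fin n → ℝ) (b : Fin m → ℝ), Q = {x | ∀ i, A i ⬝ᵥ x ≤ b i}

/-- The recession cone of a set. -/
def recCone {n : ℕ} (Q : Set (Fin n → ℝ)) : Set (Fin n → ℝ) :=
  {r | ∀ x ∈ Q, ∀ t : ℝ, 0 ≤ t → x + t • r ∈ Q}

/-- Rational polyhedral cones: solution sets of finite homogeneous systems of linear inequalities
with rational coefficients. -/
def IsRationalCone {n : ℕ} (C : Set (Fin n → ℝ)) : Prop :=
  ∃ (m : ℕ) (A : Fin m → Fin n → ℚ), C = {r | ∀ i, (fun j => (A i j : ℝ)) ⬝ᵥ r ≤ 0}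

/-- Rational polytopes: convex hulls of finitely many rational points. -/
def IsRationalPolytope {n : ℕ} (Q : Set (Fin n → ℝ)) : Prop :=
  ∃ V : Set (Fin n → ℝ), V.Finite ∧ (∀ v ∈ V, ∀ i, ∃ q : ℚ, v i = q) ∧ Q = convexHull ℝ V

/-! Write `Q` for the integer hull. A point outside `Q` violates a facet halfspace
(`exists_isFacet_notMem`), and full-dimensionality makes the halfspace of each facet unique
(`IsFacet.definesFace_unique`). A proof of that halfspace confines the leaf, hence its convex hull,
to a convex set missing the point. This gives the first inequality.

For the second, a facet `F` has the form `⟨a, x⟩ = b` with `a` primitive integral and `b` an integer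
(`IsFacet.exists_primitive_normal`). Choose `x` so close beyond the relative interior of `F` that
every `y` in `P'` with `⟨a, y⟩ ≥ b + 1/2` has `x` on a segment from `F` to `y`
(`exists_point_beyond_facet`). One `x` serves all `y` because `P'` is bounded: otherwise its
rational recession cone would contain a nonzero integer direction and `Q` would be unbounded
(`isBounded_of_isBounded_integerHull`). A pure cutting plane proof excluding `x` has a single convex
leaf set, which contains `F`, so it lies in `⟨a, y⟩ < b + 1/2`. One Chvátal–Gomory cut then rounds
to `⟨a, y⟩ ≤ b`, and its certificate is a single empty leaf: two extra nodes. -/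

open scoped Topology Pointwise

/-! ### Hyperplanes, normal vectors and faces. -/

/-- The linear functional `x ↦ ⟨a, x⟩`. -/
def dotFunctional {n : ℕ} (a : Fin n → ℝ) : (Fin n → ℝ) →ₗ[ℝ] ℝ where
  toFun x := a ⬝ᵥ x
  map_add' := dotProduct_add a
  map_smul' c x := by simp [dotProduct_smul]

theorem LinearMap.eq_dotProduct {n : ℕ} (f : (Fin n → ℝ) →ₗ[ℝ] ℝ) (x : Fin n → ℝ) :
    f x = (fun i => f (fun j => if i = j then 1 else 0)) ⬝ᵥ x := by
  rw [LinearMap.pi_apply_eq_sum_univ f x, dotProduct]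
  exact Finset.sum_congr rfl fun i _ => by rw [smul_eq_mul, mul_comm]

theorem dotProduct_self_pos_of_ne_zero {n : ℕ} {a : Fin n → ℝ} (ha : a ≠ 0) : 0 < a ⬝ᵥ a :=
  lt_of_le_of_ne (Finset.sum_nonneg fun i _ => mul_self_nonneg (a i))
    fun h => ha (dotProduct_self_eq_zero.1 h.symm)

theorem convex_closedHalfspace {n : ℕ} (a : Fin n → ℝ) (b : ℝ) :
    Convex ℝ (closedHalfspace a b) :=
  convex_halfSpace_le (dotFunctional a).isLinear b

theorem dotProduct_eq_zero_of_mem_vectorSpan {n : ℕ} {F : Set (Fin n → ℝ)} {a : Fin n → ℝ} {b : ℝ}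
    (hF : ∀ y ∈ F, a ⬝ᵥ y = b) {d : Fin n → ℝ} (hd : d ∈ vectorSpan ℝ F) : a ⬝ᵥ d = 0 := by
  have : vectorSpan ℝ F ≤ LinearMap.ker (dotFunctional a) := by
    rw [vectorSpan, Submodule.span_le]
    rintro _ ⟨y, hy, z, hz, rfl⟩
    change a ⬝ᵥ (y - z) = 0
    rw [dotProduct_sub, hF y hy, hF z hz, sub_self]
  exact this hd

/-- The direction of `F` lies in the orthogonal complement of `a`, a proper subspace since `a ≠ 0`;
the dimension leaves room only for equality. -/
theorem mem_vectorSpan_of_dotProduct_eq_zero {n : ℕ} {F : Set (Fin n → ℝ)} {a : Fin n → ℝ} {b : ℝ}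
    (hdim : Module.finrank ℝ (vectorSpan ℝ F) + 1 = n) (ha : a ≠ 0) (hF : ∀ y ∈ F, a ⬝ᵥ y = b)
    {d : Fin n → ℝ} (hd : a ⬝ᵥ d = 0) : d ∈ vectorSpan ℝ F := by
  have hle : vectorSpan ℝ F ≤ LinearMap.ker (dotFunctional a) := fun d hd =>
    dotProduct_eq_zero_of_mem_vectorSpan hF hd
  have hlt : Module.finrank ℝ (LinearMap.ker (dotFunctional a)) < Module.finrank ℝ (Fin n → ℝ) := by
    refine Submodule.finrank_lt fun h => ?_
    have : a ∈ LinearMap.ker (dotFunctional a) := h ▸ Submodule.mem_top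
    exact (dotProduct_self_pos_of_ne_zero ha).ne' this
  rw [Module.finrank_fin_fun] at hlt
  rw [Submodule.eq_of_le_of_finrank_le hle (by omega)]
  exact hd

/-- The normal vector of a set that spans a hyperplane is unique up to scaling. -/
theorem exists_smul_of_finrank_vectorSpan {n : ℕ} {F : Set (Fin n → ℝ)} {a a' : Fin n → ℝ} {b b' : ℝ}
    (hdim : Module.finrank ℝ (vectorSpan ℝ F) + 1 = n) (ha : a ≠ 0) (hF : ∀ y ∈ F, a ⬝ᵥ y = b)
    (hF' : ∀ y ∈ F, a' ⬝ᵥ y = b') : ∃ c : ℝ, a' = c • a := by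
  have hpos := dotProduct_self_pos_of_ne_zero ha
  refine ⟨(a' ⬝ᵥ a) / (a ⬝ᵥ a), ?_⟩
  refine dotProduct_eq _ _ fun y => ?_
  -- Subtracting from `y` its projection onto `a` leaves a direction of `F`, which `a'` annihilates
  -- too.
  have hy : a ⬝ᵥ (y - ((a ⬝ᵥ y) / (a ⬝ᵥ a)) • a) = 0 := by
    rw [dotProduct_sub, dotProduct_smul, smul_eq_mul]; field_simp; ring
  have := dotProduct_eq_zero_of_mem_vectorSpan hF'
    (mem_vectorSpan_of_dotProduct_eq_zero hdim ha hF hy)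
  rw [dotProduct_sub, dotProduct_smul, smul_eq_mul] at this
  rw [smul_dotProduct, smul_eq_mul]
  field_simp at this ⊢
  linarith

theorem finrank_vectorSpan_of_affineSpan_eq_top {n : ℕ} {Q : Set (Fin n → ℝ)}
    (hQ : affineSpan ℝ Q = ⊤) : Module.finrank ℝ (vectorSpan ℝ Q) = n := by
  rw [← direction_affineSpan, hQ, AffineSubspace.direction_top, finrank_top, Module.finrank_fin_fun]

theorem vectorSpan_convexHull {n : ℕ} (V : Set (Fin n → ℝ)) :
    vectorSpan ℝ (convexHull ℝ V) = vectorSpan ℝ V := by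
  rw [← direction_affineSpan, affineSpan_convexHull, direction_affineSpan]

/-- If a face of `Q` has smaller dimension than `Q`, then some point of `Q` is off the hyperplane. -/
theorem exists_dotProduct_lt {n : ℕ} {Q F : Set (Fin n → ℝ)} {a : Fin n → ℝ} {b : ℝ}
    (hdim : Module.finrank ℝ (vectorSpan ℝ F) + 1 = Module.finrank ℝ (vectorSpan ℝ Q))
    (hQ : Q ⊆ closedHalfspace a b) (hF : F = Q ∩ {x | a ⬝ᵥ x = b}) : ∃ c ∈ Q, a ⬝ᵥ c < b := by
  by_contra! h
  have : F = Q := by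
    rw [hF, Set.inter_eq_left]
    exact fun c hc => le_antisymm (hQ hc) (h c hc)
  rw [this] at hdim
  omega

/-- The halfspace that defines a facet of a full-dimensional set is unique. -/
theorem IsFacet.definesFace_unique {n : ℕ} {Q F H H' : Set (Fin n → ℝ)}
    (hQ : affineSpan ℝ Q = ⊤) (hF : IsFacet Q F) (hH : DefinesFace Q F H)
    (hH' : DefinesFace Q F H') : H' = H := by
  obtain ⟨-, ⟨f, hf⟩, hdim⟩ := hF
  obtain ⟨a, b, ha, rfl, hQa, hFa⟩ := hH
  obtain ⟨a', b', ha', rfl, hQa', hFa'⟩ := hH'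
  obtain ⟨c, hc, hcb⟩ := exists_dotProduct_lt hdim hQa hFa
  rw [finrank_vectorSpan_of_affineSpan_eq_top hQ] at hdim
  have hfa : a ⬝ᵥ f = b := (hFa ▸ hf : f ∈ Q ∩ _).2
  have hfa' : a' ⬝ᵥ f = b' := (hFa' ▸ hf : f ∈ Q ∩ _).2
  obtain ⟨t, rfl⟩ := exists_smul_of_finrank_vectorSpan (b := b) (b' := b') hdim ha
    (fun y hy => (hFa ▸ hy : y ∈ Q ∩ _).2) (fun y hy => (hFa' ▸ hy : y ∈ Q ∩ _).2)
  have h1 : (t • a) ⬝ᵥ c ≤ b' := hQa' hc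
  rw [smul_dotProduct, smul_eq_mul] at h1 hfa'
  have ht0 : t ≠ 0 := fun h => ha' (by rw [h, zero_smul])
  -- A negative factor would reverse the strict inequality at `c` and contradict `h1`.
  have ht : 0 < t := by
    refine lt_of_le_of_ne ?_ ht0.symm
    by_contra! hneg
    nlinarith
  ext y
  simp only [closedHalfspace, Set.mem_ofPred_eq, smul_dotProduct, smul_eq_mul, ← hfa', hfa]
  exact mul_le_mul_iff_right₀ ht

/-! ### Separation by facets and the first inequality. -/

/-- Points outside a full-dimensional polytope are separated by a halfspace that defines a facet. -/
theorem exists_isFacet_notMem {n : ℕ} {V : Set (Fin n → ℝ)} (hV : V.Finite)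
    (hfull : affineSpan ℝ (convexHull ℝ V) = ⊤) {x : Fin n → ℝ} (hx : x ∉ convexHull ℝ V) :
    ∃ F H, IsFacet (convexHull ℝ V) F ∧ DefinesFace (convexHull ℝ V) F H ∧ x ∉ H := by
  have hfull' := hfull
  rw [affineSpan_convexHull] at hfull'
  obtain ⟨c, hc⟩ := interior_convexHull_nonempty_iff_affineSpan_eq_top.2 hfull'
  obtain ⟨ρ, hρ, hball⟩ := Metric.isOpen_iff.1 isOpen_interior c hc
  -- The polar of the polytope about the interior point `c`: its vertices correspond to facets.
  let A : Set (Fin n → ℝ) := {a | ∀ v ∈ V, a ⬝ᵥ (v - c) ≤ 1}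
  have hAQ : ∀ a ∈ A, ∀ y ∈ convexHull ℝ V, a ⬝ᵥ y ≤ 1 + a ⬝ᵥ c := by
    intro a ha y hy
    refine convexHull_min (fun v hv => ?_) (convex_closedHalfspace a (1 + a ⬝ᵥ c)) hy
    have := ha v hv
    rw [dotProduct_sub] at this
    change a ⬝ᵥ v ≤ _
    linarith
  have hAclosed : IsClosed A := by
    have : A = ⋂ v ∈ V, {a | a ⬝ᵥ (v - c) ≤ 1} := by ext a; simp [A]
    rw [this]
    exact isClosed_biInter fun v _ =>
      isClosed_le (continuous_id.dotProduct continuous_const) continuous_const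
  have hAbdd : A ⊆ Metric.closedBall 0 (2 / ρ) := by
    intro a ha
    rw [mem_closedBall_zero_iff, pi_norm_le_iff_of_nonneg (by positivity)]
    have key : ∀ (i : Fin n) (s : ℝ), |s| < ρ → a i * s ≤ 1 := by
      intro i s hs
      have hmem : c + Pi.single i s ∈ convexHull ℝ V := by
        refine interior_subset (hball ?_)
        rw [Metric.mem_ball, dist_self_add_left, Pi.norm_single, Real.norm_eq_abs]
        exact hs
      have := hAQ a ha _ hmem
      rw [dotProduct_add, dotProduct_single] at this
      linarith
    intro i
    rw [Real.norm_eq_abs, abs_le]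
    have h1 := key i (ρ / 2) (by rw [abs_of_pos (by positivity)]; linarith)
    have h2 := key i (-(ρ / 2)) (by rw [abs_neg, abs_of_pos (by positivity)]; linarith)
    constructor
    · rw [neg_le, le_div_iff₀ hρ]; linarith
    · rw [le_div_iff₀ hρ]; linarith
  have hAcomp : IsCompact A :=
    (isCompact_closedBall (0 : Fin n → ℝ) (2 / ρ)).of_isClosed_subset hAclosed hAbdd
  -- some element of the polar separates `x`
  obtain ⟨a₀, ha₀, ha₀x⟩ : ∃ a₀ ∈ A, 1 < a₀ ⬝ᵥ (x - c) := by
    obtain ⟨f, u, hfu, hux⟩ := geometric_hahn_banach_closed_point (convex_convexHull ℝ V)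
      (hV.isClosed_convexHull ℝ) hx
    have hcu := hfu c (interior_subset hc)
    have hpos : 0 < u - f c := sub_pos.2 hcu
    let g : Fin n → ℝ := fun i => f (fun j => if i = j then 1 else 0)
    have hg : ∀ y, g ⬝ᵥ y = f y := fun y => ((f : (Fin n → ℝ) →ₗ[ℝ] ℝ).eq_dotProduct y).symm
    refine ⟨(u - f c)⁻¹ • g, fun v hv => ?_, ?_⟩
    · rw [smul_dotProduct, hg, map_sub, smul_eq_mul, inv_mul_le_iff₀ hpos]
      linarith [hfu v (subset_convexHull ℝ V hv)]
    · rw [smul_dotProduct, hg, map_sub, smul_eq_mul, lt_inv_mul_iff₀ hpos]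
      linarith
  let l : StrongDual ℝ (Fin n → ℝ) := LinearMap.toContinuousLinearMap (dotFunctional (x - c))
  have hl : ∀ a, l a = a ⬝ᵥ (x - c) := fun a => dotProduct_comm (x - c) a
  -- The elements of the polar most violated by `x` form an exposed face; an extreme point of that
  -- face is extreme in `A`.
  have hexp : IsExposed ℝ A (l.toExposed A) := ContinuousLinearMap.toExposed.isExposed
  have hne : (l.toExposed A).Nonempty := by
    obtain ⟨a, ha, hmax⟩ := hAcomp.exists_isMaxOn ⟨a₀, ha₀⟩ l.continuous.continuousOn
    exact ⟨a, ha, fun y hy => hmax hy⟩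
  obtain ⟨a, haext⟩ := (hexp.isCompact hAcomp).extremePoints_nonempty hne
  have hmax : ∀ y ∈ A, l y ≤ l a := haext.1.2
  have hext : a ∈ A.extremePoints ℝ := hexp.isExtreme.extremePoints_subset_extremePoints haext
  have haA : a ∈ A := hext.1
  have hax : 1 < a ⬝ᵥ (x - c) := by
    have := hmax a₀ ha₀
    rw [hl, hl] at this
    linarith
  have ha0 : a ≠ 0 := by
    rintro rfl
    rw [zero_dotProduct] at hax
    linarith
  -- the tight points span the space
  have hspan : Submodule.span ℝ ((fun v => v - c) '' {v ∈ V | a ⬝ᵥ (v - c) = 1}) = ⊤ := by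
    by_contra hne
    obtain ⟨f, hf0, hf⟩ := Submodule.exists_le_ker_of_lt_top _ (lt_top_iff_ne_top.2 hne)
    let d : Fin n → ℝ := fun i => f (fun j => if i = j then 1 else 0)
    have hd : ∀ y, d ⬝ᵥ y = f y := fun y => (f.eq_dotProduct y).symm
    have hd0 : d ≠ 0 := by
      intro h
      refine hf0 (LinearMap.ext fun y => ?_)
      rw [← hd, h, zero_dotProduct, LinearMap.zero_apply]
    -- Moving along `d` fixes the tight constraints and, for small steps, keeps the finitely many
    -- slack ones. Steps of both signs then contradict extremality of `a`.
    have hev : ∀ᶠ ε in 𝓝 (0 : ℝ), ∀ v ∈ V, (a + ε • d) ⬝ᵥ (v - c) ≤ 1 := by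
      rw [Filter.eventually_all_finite hV]
      intro v hv
      rcases (haA v hv).lt_or_eq with hlt | heq
      · have hcont : Continuous fun ε : ℝ => (a + ε • d) ⬝ᵥ (v - c) :=
          (continuous_const.add (continuous_id.smul continuous_const)).dotProduct continuous_const
        have := hcont.tendsto 0
        simp only [zero_smul, add_zero] at this
        filter_upwards [this.eventually_lt_const hlt] with ε hε using hε.le
      · refine Filter.Eventually.of_forall fun ε => ?_
        have : f (v - c) = 0 := hf (Submodule.subset_span ⟨v, ⟨hv, heq⟩, rfl⟩)
        rw [add_dotProduct, smul_dotProduct, hd, this, smul_zero, add_zero, heq]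
    obtain ⟨r, hr, hrball⟩ := Metric.eventually_nhds_iff.1 hev
    have h1 : a + (r / 2) • d ∈ A :=
      hrball (by rw [dist_zero_right, Real.norm_eq_abs, abs_of_pos (by positivity)]; linarith)
    have h2 : a + (-(r / 2)) • d ∈ A :=
      hrball (by rw [dist_zero_right, Real.norm_eq_abs, abs_neg, abs_of_pos (by positivity)]
                 linarith)
    have hmid : a ∈ openSegment ℝ (a + (r / 2) • d) (a + (-(r / 2)) • d) :=
      ⟨1 / 2, 1 / 2, by norm_num, by norm_num, by norm_num, by module⟩
    have := hext.2 h1 h2 hmid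
    rw [add_eq_left, smul_eq_zero] at this
    exact this.elim (by positivity) hd0
  have hsub : convexHull ℝ V ⊆ closedHalfspace a (1 + a ⬝ᵥ c) := hAQ a haA
  have hdef : DefinesFace (convexHull ℝ V) (convexHull ℝ V ∩ {y | a ⬝ᵥ y = 1 + a ⬝ᵥ c})
      (closedHalfspace a (1 + a ⬝ᵥ c)) := ⟨a, _, ha0, rfl, hsub, rfl⟩
  set F := convexHull ℝ V ∩ {y | a ⬝ᵥ y = 1 + a ⬝ᵥ c} with hF
  have htight : ∀ v, v ∈ V ∧ a ⬝ᵥ (v - c) = 1 → v ∈ F := by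
    rintro v ⟨hv, h⟩
    refine ⟨subset_convexHull ℝ V hv, ?_⟩
    rw [dotProduct_sub] at h
    change a ⬝ᵥ v = _
    linarith
  have hFne : F.Nonempty := by
    by_contra hemp
    have : {v ∈ V | a ⬝ᵥ (v - c) = 1} = ∅ :=
      Set.eq_empty_of_forall_notMem fun v hv => hemp ⟨v, htight v hv⟩
    rw [this, Set.image_empty, Submodule.span_empty] at hspan
    have hmem : a ∈ (⊥ : Submodule ℝ (Fin n → ℝ)) := hspan ▸ Submodule.mem_top
    exact ha0 ((Submodule.mem_bot ℝ).1 hmem)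
  refine ⟨F, _, ⟨⟨_, hdef⟩, hFne, ?_⟩, hdef, ?_⟩
  · rw [finrank_vectorSpan_of_affineSpan_eq_top hfull]
    obtain ⟨f, hf⟩ := hFne
    -- The tight vectors `v - c` span everything and differ from `f - c` by directions of `F`, so
    -- `F` loses at most one dimension.
    have hle : (⊤ : Submodule ℝ (Fin n → ℝ)) ≤ vectorSpan ℝ F ⊔ ℝ ∙ (f - c) := by
      rw [← hspan, Submodule.span_le]
      rintro _ ⟨v, hv, rfl⟩
      change v - c ∈ _
      have : v - c = (v - f) + (f - c) := by abel
      rw [this]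
      exact Submodule.add_mem_sup (vsub_mem_vectorSpan ℝ (htight v hv) hf)
        (Submodule.mem_span_singleton_self _)
    have h1 := Submodule.finrank_mono hle
    have h2 := Submodule.finrank_add_le_finrank_add_finrank (vectorSpan ℝ F) (ℝ ∙ (f - c))
    have h3 := finrank_span_le_card (R := ℝ) ({f - c} : Set (Fin n → ℝ))
    rw [Set.toFinset_singleton, Finset.card_singleton] at h3
    rw [finrank_top, Module.finrank_fin_fun] at h1
    have h4 : Module.finrank ℝ (vectorSpan ℝ F) < Module.finrank ℝ (Fin n → ℝ) := by
      refine Submodule.finrank_lt fun h => ?_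
      have hmem : a ∈ vectorSpan ℝ F := h ▸ Submodule.mem_top
      exact (dotProduct_self_pos_of_ne_zero ha0).ne'
        (dotProduct_eq_zero_of_mem_vectorSpan (fun y hy => hy.2) hmem)
    rw [Module.finrank_fin_fun] at h4
    omega
  · intro h
    have : a ⬝ᵥ x ≤ 1 + a ⬝ᵥ c := h
    rw [dotProduct_sub] at hax
    linarith

/-- Any proof of a halfspace is also a membership proof for every point outside it, since halfspaces
are convex. -/
theorem membershipComplexity_le_facetComplexity {n : ℕ} (S : ProofSystem n)
    (L : List (Set (Fin n → ℝ))) (hfull : affineSpan ℝ (integerHull L) = ⊤)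
    (hrat : IsRationalPolytope (integerHull L)) :
    membershipComplexity S L ≤ facetComplexity S L := by
  refine iSup₂_le fun x hx => ?_
  obtain ⟨V, hV, -, hVL⟩ := hrat
  obtain ⟨F, H, hF, hH, hxH⟩ := exists_isFacet_notMem hV (hVL ▸ hfull) (hVL ▸ hx)
  rw [← hVL] at hF hH
  refine le_trans ?_ (le_iSup₂ F hF)
  refine le_iInf₂ fun H' hH' => le_iInf₂ fun T hT => iInf₂_le T ⟨hT.1, fun hxT => hxH ?_⟩
  rw [← hF.definesFace_unique hfull hH hH']
  obtain ⟨a, b, -, rfl, -⟩ := hH'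
  exact convexHull_min hT.2 (convex_closedHalfspace a b) hxT

/-! ### Rational approximation and boundedness of the relaxation. -/

/-- A real vector can be approximated by rational vectors that satisfy the same rational linear
equations. -/
theorem exists_rat_mem_nhds_of_relations {n : ℕ} (r : Fin n → ℝ) {U : Set (Fin n → ℝ)}
    (hU : U ∈ 𝓝 r) :
    ∃ q : Fin n → ℚ, (fun j => (q j : ℝ)) ∈ U ∧
      ∀ w : Fin n → ℚ, (fun j => (w j : ℝ)) ⬝ᵥ r = 0 → w ⬝ᵥ q = 0 := by
  -- Write the entries of `r` in a `ℚ`-basis of their span and move the basis elements to nearby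
  -- rationals. This is a `ℚ`-linear map, so it preserves every rational relation among the entries.
  let W := Submodule.span ℚ (Set.range r)
  have : FiniteDimensional ℚ W := FiniteDimensional.span_of_finite ℚ (Set.finite_range r)
  let B := Module.finBasis ℚ W
  let r' : Fin n → W := fun j => ⟨r j, Submodule.subset_span ⟨j, rfl⟩⟩
  let φ : (Fin (Module.finrank ℚ W) → ℝ) → Fin n → ℝ := fun c j => ∑ k, (B.repr (r' j) k : ℝ) * c k
  have hφ : Continuous φ := by fun_prop
  have hφB : φ (fun k => (B k : ℝ)) = r := by
    funext j
    have h := congrArg (fun w : W => (w : ℝ)) (B.sum_repr (r' j))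
    simp only [AddSubmonoidClass.coe_finsetSum, Submodule.coe_smul, Rat.smul_def] at h
    exact h
  obtain ⟨V, hVU, hVo, hrV⟩ := mem_nhds_iff.1 hU
  have hdense : DenseRange (fun (c : Fin (Module.finrank ℚ W) → ℚ) k => (c k : ℝ)) :=
    DenseRange.piMap fun _ => Rat.denseRange_cast
  obtain ⟨c, hc⟩ := hdense.exists_mem_open (hVo.preimage hφ)
    ⟨fun k => (B k : ℝ), by rw [Set.mem_preimage, hφB]; exact hrV⟩
  refine ⟨fun j => B.constr ℚ c (r' j), hVU ?_, fun w hw => ?_⟩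
  · have : (fun j => ((B.constr ℚ c (r' j) : ℚ) : ℝ)) = φ (fun k => (c k : ℝ)) := by
      funext j
      simp [φ, Module.Basis.constr_apply_fintype]
    rw [this]
    exact hc
  · have h0 : ∑ j, w j • r' j = 0 := by
      apply Subtype.ext
      simpa [r', Rat.smul_def, dotProduct] using hw
    have := congrArg (B.constr ℚ c) h0
    simpa [dotProduct] using this

/-- A rational vector has a positive multiple that is an integer vector. -/
theorem exists_pos_nat_smul_eq_intCast {n : ℕ} (q : Fin n → ℚ) :
    ∃ (N : ℕ) (z : Fin n → ℤ), 0 < N ∧ ∀ j, (z j : ℝ) = N * (q j : ℝ) := by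
  have hdvd : ∀ j, (q j).den ∣ ∏ i, (q i).den := fun j =>
    Finset.dvd_prod_of_mem (fun i => (q i).den) (Finset.mem_univ j)
  choose m hm using hdvd
  refine ⟨∏ i, (q i).den, fun j => m j * (q j).num, Finset.prod_pos fun i _ => (q i).den_pos,
    fun j => ?_⟩
  have h : ((q j : ℚ) : ℝ) * ((q j).den : ℝ) = ((q j).num : ℝ) := by
    exact_mod_cast Rat.mul_den_eq_num (q j)
  rw [hm j]
  push_cast
  rw [← h]
  ring

/-- An unbounded polyhedron has a nonzero recession direction. -/
theorem IsPolyhedron.exists_recCone_ne_zero {n : ℕ} {Q : Set (Fin n → ℝ)} (hQ : IsPolyhedron Q)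
    (hunb : ¬ Bornology.IsBounded Q) : ∃ r ∈ recCone Q, r ≠ 0 := by
  obtain ⟨m, A, b, rfl⟩ := hQ
  have hex : ∀ k : ℕ, ∃ y, (∀ i, A i ⬝ᵥ y ≤ b i) ∧ (k : ℝ) + 1 < ‖y‖ := by
    intro k
    by_contra! h
    exact hunb (isBounded_iff_forall_norm_le.2 ⟨k + 1, fun y hy => h y hy⟩)
  choose y hyQ hyk using hex
  have hpos : ∀ k, 0 < ‖y k‖ := fun k => lt_trans (by positivity) (hyk k)
  -- A limit of the normalised points; dividing each constraint by the growing norm makes its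
  -- right-hand side vanish.
  obtain ⟨r, hr, φ, hφ, hlim⟩ := (isCompact_sphere (0 : Fin n → ℝ) 1).tendsto_subseq
    (x := fun k => ‖y k‖⁻¹ • y k) (fun k => by
      rw [mem_sphere_zero_iff_norm, norm_smul, norm_inv, norm_norm,
        inv_mul_cancel₀ (hpos k).ne'])
  have hinv : Filter.Tendsto (fun k => ‖y k‖⁻¹) Filter.atTop (𝓝 0) := by
    refine tendsto_inv_atTop_zero.comp ?_
    refine Filter.tendsto_atTop_mono (fun k => (hyk k).le) ?_
    exact Filter.tendsto_atTop_add_const_right _ _ tendsto_natCast_atTop_atTop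
  refine ⟨r, fun x hx t ht i => ?_, ?_⟩
  · have h1 : A i ⬝ᵥ r ≤ 0 := by
      have hl : Filter.Tendsto (fun k => A i ⬝ᵥ (‖y (φ k)‖⁻¹ • y (φ k))) Filter.atTop
          (𝓝 (A i ⬝ᵥ r)) :=
        ((continuous_const.dotProduct continuous_id).tendsto r).comp hlim
      have hr' : Filter.Tendsto (fun k => ‖y (φ k)‖⁻¹ * b i) Filter.atTop (𝓝 0) := by
        simpa using (hinv.comp hφ.tendsto_atTop).mul_const (b i)
      refine le_of_tendsto_of_tendsto' hl hr' fun k => ?_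
      rw [dotProduct_smul, smul_eq_mul]
      exact mul_le_mul_of_nonneg_left (hyQ _ i) (inv_nonneg.2 (norm_nonneg _))
    rw [dotProduct_add, dotProduct_smul, smul_eq_mul]
    have h2 : A i ⬝ᵥ x ≤ b i := hx i
    nlinarith
  · rintro rfl
    rw [mem_sphere_zero_iff_norm, norm_zero] at hr
    exact zero_ne_one hr

/-- A nonzero rational cone contains a nonzero integer vector. -/
theorem IsRationalCone.exists_int_mem {n : ℕ} {C : Set (Fin n → ℝ)} (hC : IsRationalCone C)
    {r : Fin n → ℝ} (hr : r ∈ C) (hr0 : r ≠ 0) :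
    ∃ z : Fin n → ℤ, z ≠ 0 ∧ (fun j => (z j : ℝ)) ∈ C := by
  obtain ⟨m, A, rfl⟩ := hC
  -- Slack constraints survive in a neighbourhood; tight ones are rational relations, which the
  -- approximation keeps exactly.
  have hU : {s : Fin n → ℝ | s ≠ 0 ∧ ∀ i, (fun j => (A i j : ℝ)) ⬝ᵥ r < 0 →
      (fun j => (A i j : ℝ)) ⬝ᵥ s < 0} ∈ 𝓝 r := by
    refine Filter.Eventually.and (isOpen_ne.mem_nhds hr0) (Filter.eventually_all.2 fun i => ?_)
    by_cases h : (fun j => (A i j : ℝ)) ⬝ᵥ r < 0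
    · have hcont : Continuous fun s : Fin n → ℝ => (fun j => (A i j : ℝ)) ⬝ᵥ s :=
        continuous_const.dotProduct continuous_id
      filter_upwards [(hcont.tendsto r).eventually_lt_const h] with s hs _ using hs
    · exact Filter.Eventually.of_forall fun s h' => absurd h' h
  obtain ⟨q, ⟨hq0, hq⟩, hrel⟩ := exists_rat_mem_nhds_of_relations r hU
  obtain ⟨N, z, hN, hz⟩ := exists_pos_nat_smul_eq_intCast q
  have hN' : (0 : ℝ) < N := by exact_mod_cast hN
  have hzq : (fun j => (z j : ℝ)) = (N : ℝ) • fun j => (q j : ℝ) := funext hz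
  refine ⟨z, ?_, fun i => ?_⟩
  · rintro rfl
    refine hq0 (funext fun j => ?_)
    have := hz j
    simpa [hN.ne'] using this
  · rw [hzq, dotProduct_smul, smul_eq_mul]
    refine mul_nonpos_of_nonneg_of_nonpos hN'.le ?_
    have hri : (fun j => (A i j : ℝ)) ⬝ᵥ r ≤ 0 := hr i
    rcases hri.lt_or_eq with h | h
    · exact (hq i h).le
    · refine le_of_eq ?_
      have := hrel (A i) h
      simp only [dotProduct] at this ⊢
      exact_mod_cast this

/-- A polyhedron with rational recession cone is bounded if its integer hull is bounded
and nonempty. -/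
theorem isBounded_of_isBounded_integerHull {n : ℕ} {L : List (Set (Fin n → ℝ))}
    (hpoly : IsPolyhedron (labelSet L)) (hrec : IsRationalCone (recCone (labelSet L)))
    (hne : (labelSet L ∩ intLattice n).Nonempty)
    (hbdd : Bornology.IsBounded (integerHull L)) : Bornology.IsBounded (labelSet L) := by
  by_contra hunb
  obtain ⟨r, hr, hr0⟩ := hpoly.exists_recCone_ne_zero hunb
  obtain ⟨z, hz0, hz⟩ := hrec.exists_int_mem hr hr0
  obtain ⟨x, hxL, hxZ⟩ := hne
  obtain ⟨j, hj⟩ := Function.ne_iff.1 hz0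
  obtain ⟨R, hR⟩ := isBounded_iff_forall_norm_le.1 hbdd
  -- The integer direction turns one lattice point into an unbounded sequence of them.
  have hmem : ∀ k : ℕ, x + (k : ℝ) • (fun j => (z j : ℝ)) ∈ integerHull L := by
    refine fun k => subset_convexHull ℝ _ ⟨hz x hxL k k.cast_nonneg, fun i => ?_⟩
    obtain ⟨y, hy⟩ := hxZ i
    exact ⟨y + k * z i, by simp [hy]⟩
  have hbound : ∀ k : ℕ, (k : ℝ) ≤ R + |x j| := by
    intro k
    have h1 := (norm_le_pi_norm _ j).trans (hR _ (hmem k))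
    have h2 : (1 : ℝ) ≤ |(z j : ℝ)| := by exact_mod_cast Int.one_le_abs hj
    rw [Pi.add_apply, Pi.smul_apply, smul_eq_mul, Real.norm_eq_abs] at h1
    have h3 : |(k : ℝ) * z j| ≤ |x j + k * z j| + |x j| := by
      have := abs_sub (x j + k * z j) (x j)
      rwa [add_sub_cancel_left] at this
    rw [abs_mul, Nat.abs_cast] at h3
    nlinarith [(k.cast_nonneg : (0 : ℝ) ≤ k)]
  obtain ⟨k, hk⟩ := exists_nat_gt (R + |x j|)
  exact absurd (hbound k) (not_le.2 hk)

/-! ### Chvátal–Gomory rounding. -/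

/-- The integer points of a rational halfspace with primitive integer normal vector span the
halfspace with rounded right-hand side. -/
theorem convexHull_closedHalfspace_inter_intLattice {n : ℕ} {a : Fin n → ℤ} {b : ℤ} {β : ℝ}
    (hb : b ≤ β) (hβ : β < b + 1) (ha : ∃ w : Fin n → ℤ, a ⬝ᵥ w = 1) :
    convexHull ℝ (closedHalfspace (fun j => (a j : ℝ)) β ∩ intLattice n) =
      closedHalfspace (fun j => (a j : ℝ)) b := by
  have hcast : ∀ z : Fin n → ℤ, (fun j => (a j : ℝ)) ⬝ᵥ (fun j => (z j : ℝ)) = ((a ⬝ᵥ z : ℤ) : ℝ) :=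
    fun z => by simp [dotProduct]
  refine Set.Subset.antisymm (convexHull_min ?_ (convex_closedHalfspace _ _)) ?_
  · rintro x ⟨hx, hxz⟩
    choose z hz using hxz
    obtain rfl : x = fun j => (z j : ℝ) := funext hz
    change _ ≤ (b : ℝ)
    have hx' : (fun j => (a j : ℝ)) ⬝ᵥ (fun j => (z j : ℝ)) ≤ β := hx
    rw [hcast] at hx' ⊢
    have : ((a ⬝ᵥ z : ℤ) : ℝ) < (b + 1 : ℤ) := by push_cast; linarith
    exact_mod_cast Int.lt_add_one_iff.1 (by exact_mod_cast this)
  obtain ⟨w, hw⟩ := ha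
  set a' : Fin n → ℝ := fun j => (a j : ℝ) with ha'
  obtain ⟨i, hi⟩ : ∃ i, a i ≠ 0 := by
    by_contra! h
    obtain rfl : a = 0 := funext h
    simp at hw
  have hi' : a' i ≠ 0 := Int.cast_ne_zero.2 hi
  -- It suffices to show that the homogeneous lattice points have the whole halfspace as hull;
  -- translation by `b • w` then gives right-hand side `b`.
  let M : Set (Fin n → ℝ) := {z | a' ⬝ᵥ z ≤ 0} ∩ intLattice n
  have hMint : ∀ z : Fin n → ℤ, a ⬝ᵥ z ≤ 0 → (fun j => (z j : ℝ)) ∈ M := fun z hz =>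
    ⟨by change _ ≤ (0 : ℝ); rw [hcast]; exact_mod_cast hz, fun j => ⟨z j, rfl⟩⟩
  have hadd : ∀ x ∈ convexHull ℝ M, ∀ y ∈ convexHull ℝ M, x + y ∈ convexHull ℝ M := by
    intro x hx y hy
    have := Set.add_mem_add hx hy
    rw [← convexHull_add] at this
    refine convexHull_mono ?_ this
    rintro _ ⟨u, ⟨hu, huz⟩, v, ⟨hv, hvz⟩, rfl⟩
    refine ⟨?_, fun j => ?_⟩
    · change a' ⬝ᵥ (u + v) ≤ 0
      rw [dotProduct_add]
      exact add_nonpos hu hv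
    · obtain ⟨p, hp⟩ := huz j
      obtain ⟨q, hq⟩ := hvz j
      exact ⟨p + q, by simp [hp, hq]⟩
  have hzero : (0 : Fin n → ℝ) ∈ convexHull ℝ M :=
    subset_convexHull ℝ _ ⟨by simp, fun j => ⟨0, by simp⟩⟩
  have hsmul : ∀ z ∈ M, ∀ t : ℝ, 0 ≤ t → t • z ∈ convexHull ℝ M := by
    rintro z ⟨hz, hzz⟩ t ht
    obtain ⟨k, hk⟩ := exists_nat_gt t
    have hkpos : (0 : ℝ) < k := ht.trans_lt hk
    have hkz : (k : ℝ) • z ∈ convexHull ℝ M := by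
      refine subset_convexHull ℝ _ ⟨?_, fun j => ?_⟩
      · change a' ⬝ᵥ ((k : ℝ) • z) ≤ 0
        rw [dotProduct_smul, smul_eq_mul]
        exact mul_nonpos_of_nonneg_of_nonpos hkpos.le hz
      · obtain ⟨p, hp⟩ := hzz j
        exact ⟨k * p, by simp [hp]⟩
    have := (convex_convexHull ℝ M).smul_mem_of_zero_mem hzero hkz
      (t := t / k) ⟨by positivity, (div_le_one hkpos).2 hk.le⟩
    rwa [smul_smul, div_mul_cancel₀ _ hkpos.ne'] at this
  have hsmul' : ∀ z : Fin n → ℤ, a ⬝ᵥ z = 0 → ∀ t : ℝ,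
      t • (fun j => (z j : ℝ)) ∈ convexHull ℝ M := by
    intro z hz t
    rcases le_total 0 t with ht | ht
    · exact hsmul _ (hMint z hz.le) t ht
    · have := hsmul _ (hMint (-z) (by rw [dotProduct_neg, hz, neg_zero])) (-t) (neg_nonneg.2 ht)
      convert this using 1
      funext j
      simp
  have hsum : ∀ (s : Finset (Fin n)) (f : Fin n → Fin n → ℝ), (∀ j, f j ∈ convexHull ℝ M) →
      ∑ j ∈ s, f j ∈ convexHull ℝ M := by
    intro s f hf
    induction s using Finset.induction_on with
    | empty => simpa using hzero
    | insert j s hj ih => rw [Finset.sum_insert hj]; exact hadd _ (hf j) _ ih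
  have hcone : ∀ v : Fin n → ℝ, a' ⬝ᵥ v ≤ 0 → v ∈ convexHull ℝ M := by
    intro v hv
    -- Decompose `v` as a nonnegative multiple of `-a i • e_i` plus real multiples of the lattice
    -- vectors `a i • e_j - a j • e_i`, which are orthogonal to `a`.
    have h1 : (-(a' ⬝ᵥ v) / (a' i * a' i)) • (fun j => ((Pi.single i (-a i) : Fin n → ℤ) j : ℝ)) ∈
        convexHull ℝ M := by
      refine hsmul _ (hMint _ ?_) _ (div_nonneg (neg_nonneg.2 hv) (mul_self_nonneg _))
      rw [dotProduct_single]
      nlinarith [mul_self_nonneg (a i)]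
    have h2 := hsum Finset.univ (fun j => (v j / a' i) •
      (fun k => ((Pi.single j (a i) - Pi.single i (a j) : Fin n → ℤ) k : ℝ))) (fun j => by
        refine hsmul' _ ?_ _
        rw [dotProduct_sub, dotProduct_single, dotProduct_single]
        ring)
    convert hadd _ h1 _ h2 using 1
    funext k
    simp only [Pi.add_apply, Pi.smul_apply, Finset.sum_apply, smul_eq_mul, Pi.sub_apply,
      Int.cast_sub, mul_sub, Finset.sum_sub_distrib]
    have e1 : ∑ j, v j / a' i * ((Pi.single j (a i) : Fin n → ℤ) k : ℝ) = v k := by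
      rw [Finset.sum_eq_single k]
      · simp only [Pi.single_eq_same]
        exact div_mul_cancel₀ _ hi'
      · intro j _ hjk
        simp [Pi.single_eq_of_ne' hjk]
      · simp
    rw [e1]
    by_cases hk : k = i
    · subst hk
      have e2 : ∑ j, v j / a' k * ((Pi.single k (a j) : Fin n → ℤ) k : ℝ) = (a' ⬝ᵥ v) / a' k := by
        rw [dotProduct, Finset.sum_div]
        refine Finset.sum_congr rfl fun j _ => ?_
        simp only [Pi.single_eq_same, ha']
        ring
      rw [e2, Pi.single_eq_same, Int.cast_neg]
      change _ = -(a' ⬝ᵥ v) / (a' k * a' k) * -a' k + _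
      field_simp
      ring
    · simp [Pi.single_eq_of_ne hk]
  intro y hy
  have hy' : a' ⬝ᵥ y ≤ b := hy
  let z₀ : Fin n → ℝ := fun j => ((b * w j : ℤ) : ℝ)
  have hz₀ : a' ⬝ᵥ z₀ = b := by
    rw [hcast]
    change (((a ⬝ᵥ (b • w)) : ℤ) : ℝ) = b
    rw [dotProduct_smul, hw, smul_eq_mul, mul_one]
  have hv : y - z₀ ∈ convexHull ℝ M := hcone _ (by rw [dotProduct_sub, hz₀]; linarith)
  have hy2 : y ∈ convexHull ℝ (z₀ +ᵥ M) := by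
    rw [convexHull_vadd]
    exact ⟨y - z₀, hv, by simp⟩
  refine convexHull_mono ?_ hy2
  rintro _ ⟨u, ⟨hu, huz⟩, rfl⟩
  refine ⟨?_, fun j => ?_⟩
  · change a' ⬝ᵥ (z₀ + u) ≤ β
    have hu' : a' ⬝ᵥ u ≤ 0 := hu
    rw [dotProduct_add, hz₀]
    linarith
  · obtain ⟨p, hp⟩ := huz j
    exact ⟨b * w j + p, by simp [z₀, hp]⟩

/-! ### Integrality of facet normals. -/

/-- If an inner point of a segment in `⟨a, x⟩ ≤ b` attains equality, so do both ends. Hence the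
faces of an integer hull are spanned by lattice points. -/
theorem convexHull_inter_hyperplane {n : ℕ} {P : Set (Fin n → ℝ)} {a : Fin n → ℝ} {b : ℝ}
    (hP : ∀ x ∈ P, a ⬝ᵥ x ≤ b) :
    convexHull ℝ P ∩ {x | a ⬝ᵥ x = b} = convexHull ℝ (P ∩ {x | a ⬝ᵥ x = b}) := by
  refine Set.Subset.antisymm ?_ (Set.subset_inter (convexHull_mono Set.inter_subset_left)
    (convexHull_min Set.inter_subset_right
      (convex_hyperplane (dotFunctional a).isLinear b)))
  rintro x ⟨hx, hxb⟩
  have hconv : Convex ℝ {x | a ⬝ᵥ x ≤ b ∧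
      (a ⬝ᵥ x = b → x ∈ convexHull ℝ (P ∩ {x | a ⬝ᵥ x = b}))} := by
    rw [convex_iff_forall_pos]
    rintro x ⟨hx, hx'⟩ y ⟨hy, hy'⟩ s t hs ht hst
    have hval : a ⬝ᵥ (s • x + t • y) = s * a ⬝ᵥ x + t * a ⬝ᵥ y := by
      rw [dotProduct_add, dotProduct_smul, dotProduct_smul, smul_eq_mul, smul_eq_mul]
    obtain rfl : s = 1 - t := by linarith
    refine ⟨by rw [hval]; nlinarith, fun h => ?_⟩
    rw [hval] at h
    exact convex_convexHull ℝ _ (hx' (by nlinarith)) (hy' (by nlinarith)) hs.le ht.le hst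
  have hsub : P ⊆ {x | a ⬝ᵥ x ≤ b ∧
      (a ⬝ᵥ x = b → x ∈ convexHull ℝ (P ∩ {x | a ⬝ᵥ x = b}))} :=
    fun z hz => ⟨hP z hz, fun h => subset_convexHull ℝ _ ⟨hz, h⟩⟩
  exact (convexHull_min hsub hconv hx).2 hxb

/-- A nonzero integer vector is a positive multiple of a primitive one. -/
theorem exists_primitive_of_ne_zero {n : ℕ} {z : Fin n → ℤ} (hz : z ≠ 0) :
    ∃ (g : ℤ) (a w : Fin n → ℤ), 0 < g ∧ (∀ j, z j = g * a j) ∧ a ⬝ᵥ w = 1 := by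
  -- The positive generator of this principal ideal is the gcd of the entries, and `w` collects
  -- Bézout coefficients.
  let I : Ideal ℤ := Ideal.span (Set.range z)
  obtain ⟨g₀, hg₀⟩ := (IsPrincipalIdealRing.principal I).principal
  have hgI : I = Ideal.span {|g₀|} := by
    rw [hg₀, Ideal.submodule_span_eq, Ideal.span_singleton_eq_span_singleton]
    exact Int.associated_iff_natAbs.2 (Int.natAbs_abs g₀).symm
  have hdvd : ∀ j, |g₀| ∣ z j := fun j => by
    rw [← Ideal.mem_span_singleton, ← hgI]
    exact Ideal.subset_span ⟨j, rfl⟩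
  choose a ha using hdvd
  have hg : 0 < |g₀| := by
    refine abs_pos.2 fun h => hz (funext fun j => ?_)
    rw [ha j, h, abs_zero, zero_mul, Pi.zero_apply]
  have hmem : |g₀| ∈ I := hgI ▸ Ideal.mem_span_singleton_self _
  obtain ⟨w, hw⟩ := (Ideal.mem_span_range_iff_exists_fun).1 hmem
  refine ⟨|g₀|, a, w, hg, ha, ?_⟩
  have h : |g₀| * (a ⬝ᵥ w) = |g₀| * 1 := by
    rw [mul_one]
    refine Eq.trans ?_ hw
    rw [dotProduct, Finset.mul_sum]
    refine Finset.sum_congr rfl fun j _ => ?_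
    rw [ha j]
    ring
  exact mul_left_cancel₀ hg.ne' h

/-- Facets of a full-dimensional integer hull have primitive integer normal vectors. -/
theorem IsFacet.exists_primitive_normal {n : ℕ} {L : List (Set (Fin n → ℝ))}
    {F : Set (Fin n → ℝ)} (hfull : affineSpan ℝ (integerHull L) = ⊤)
    (hF : IsFacet (integerHull L) F) :
    ∃ (a : Fin n → ℤ) (b : ℤ), (∃ w : Fin n → ℤ, a ⬝ᵥ w = 1) ∧ (fun j => (a j : ℝ)) ≠ 0 ∧
      integerHull L ⊆ closedHalfspace (fun j => (a j : ℝ)) b ∧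
      F = integerHull L ∩ {x | (fun j => (a j : ℝ)) ⬝ᵥ x = b} := by
  obtain ⟨⟨H, a₀, b₀, ha₀, rfl, hsub, hFeq⟩, hne, hdim⟩ := hF
  rw [finrank_vectorSpan_of_affineSpan_eq_top hfull] at hdim
  set PF := (labelSet L ∩ intLattice n) ∩ {x | a₀ ⬝ᵥ x = b₀} with hPF
  have hFconv : F = convexHull ℝ PF := by
    rw [hFeq]
    exact convexHull_inter_hyperplane fun x hx => hsub (subset_convexHull ℝ _ hx)
  rw [hFconv, vectorSpan_convexHull] at hdim
  obtain ⟨x₀, hx₀⟩ : PF.Nonempty := convexHull_nonempty_iff.1 (hFconv ▸ hne)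
  obtain ⟨j, hj⟩ := Function.ne_iff.1 ha₀
  -- The rational vector stays orthogonal to all integer vectors orthogonal to `a₀`, in particular
  -- to differences of lattice points of `F`. The open set keeps it nonzero and fixes its
  -- orientation.
  obtain ⟨q, hqU, hq⟩ := exists_rat_mem_nhds_of_relations a₀
    (U := {s | 0 < s j * a₀ j})
    ((isOpen_lt continuous_const ((continuous_apply j).mul continuous_const)).mem_nhds
      (mul_self_pos.2 hj))
  obtain ⟨N, z, hN, hz⟩ := exists_pos_nat_smul_eq_intCast q
  have hN' : (0 : ℝ) < N := by exact_mod_cast hN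
  have hzj : 0 < (z j : ℝ) * a₀ j := by
    rw [hz, mul_assoc]
    exact mul_pos hN' hqU
  have hzorth : ∀ d : Fin n → ℤ, a₀ ⬝ᵥ (fun j => (d j : ℝ)) = 0 →
      (fun j => (z j : ℝ)) ⬝ᵥ (fun j => (d j : ℝ)) = 0 := by
    intro d hd
    have h := hq (fun j => (d j : ℚ)) (by rw [dotProduct_comm]; simpa using hd)
    have h' : (fun j => (q j : ℝ)) ⬝ᵥ (fun j => (d j : ℝ)) = 0 := by
      rw [dotProduct_comm]
      simp only [dotProduct] at h ⊢
      exact_mod_cast h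
    have hzq : (fun j => (z j : ℝ)) = (N : ℝ) • fun j => (q j : ℝ) := funext hz
    rw [hzq, smul_dotProduct, h', smul_zero]
  have hz0 : z ≠ 0 := by
    rintro rfl
    simp at hzj
  obtain ⟨g, a, w, hg, hza, haw⟩ := exists_primitive_of_ne_zero hz0
  have hg' : (0 : ℝ) < g := by exact_mod_cast hg
  choose y₀ hy₀ using hx₀.1.2
  have hx₀y : x₀ = fun j => (y₀ j : ℝ) := funext hy₀
  have hconst : ∀ x ∈ PF, (fun j => (z j : ℝ)) ⬝ᵥ x = (fun j => (z j : ℝ)) ⬝ᵥ x₀ := by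
    intro x hx
    choose y hy using hx.1.2
    have hxy : x - x₀ = fun j => ((y j - y₀ j : ℤ) : ℝ) := by
      funext j
      simp [hy j, hy₀ j]
    have h1 : a₀ ⬝ᵥ (x - x₀) = 0 := by
      have e1 : a₀ ⬝ᵥ x = b₀ := hx.2
      have e2 : a₀ ⬝ᵥ x₀ = b₀ := hx₀.2
      rw [dotProduct_sub, e1, e2, sub_self]
    rw [hxy] at h1
    have h2 := hzorth _ h1
    rw [← hxy, dotProduct_sub] at h2
    linarith
  obtain ⟨c, hc⟩ := exists_smul_of_finrank_vectorSpan hdim ha₀ (fun x hx => hx.2) hconst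
  have hcpos : 0 < c := by
    have h1 : (z j : ℝ) = c * a₀ j := congrFun hc j
    rw [h1, mul_assoc] at hzj
    exact pos_of_mul_pos_left hzj (mul_self_nonneg _)
  have hat : (fun j => (a j : ℝ)) = (c / g) • a₀ := by
    funext j
    have h1 : (z j : ℝ) = c * a₀ j := congrFun hc j
    have h2 : (z j : ℝ) = g * a j := by exact_mod_cast hza j
    rw [Pi.smul_apply, smul_eq_mul]
    field_simp
    linarith
  have ht : 0 < c / g := div_pos hcpos hg'
  have hval : ∀ x, (fun j => (a j : ℝ)) ⬝ᵥ x = (c / g) * a₀ ⬝ᵥ x := fun x => by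
    rw [hat, smul_dotProduct, smul_eq_mul]
  have hb : ((a ⬝ᵥ y₀ : ℤ) : ℝ) = (c / g) * b₀ := by
    have e2 : a₀ ⬝ᵥ x₀ = b₀ := hx₀.2
    rw [← e2, ← hval, hx₀y]
    simp [dotProduct]
  refine ⟨a, a ⬝ᵥ y₀, ⟨w, haw⟩, ?_, fun x hx => ?_, ?_⟩
  · rw [hat]
    exact smul_ne_zero ht.ne' ha₀
  · change (fun j => (a j : ℝ)) ⬝ᵥ x ≤ ((a ⬝ᵥ y₀ : ℤ) : ℝ)
    rw [hval, hb]
    exact mul_le_mul_of_nonneg_left (hsub hx) ht.le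
  · rw [hFeq]
    ext x
    simp only [Set.mem_inter_iff, Set.mem_ofPred_eq, hval, hb, mul_right_inj' ht.ne']

/-! ### Points just beyond a facet. -/

/-- Just beyond a relative interior point of a facet there is a point that lies in the convex hull
of the facet and any point of a bounded set that is far enough beyond the facet. -/
theorem exists_point_beyond_facet {n : ℕ} {F B : Set (Fin n → ℝ)} {a : Fin n → ℝ} {b : ℝ}
    (hconv : Convex ℝ F) (hne : F.Nonempty)
    (hdim : Module.finrank ℝ (vectorSpan ℝ F) + 1 = n) (ha : a ≠ 0)
    (hF : ∀ y ∈ F, a ⬝ᵥ y = b) (hB : Bornology.IsBounded B) :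
    ∃ x, b < a ⬝ᵥ x ∧ ∀ y ∈ B, b + 1 / 2 ≤ a ⬝ᵥ y → ∃ q ∈ F, x ∈ segment ℝ q y := by
  obtain ⟨p, hp⟩ := hne.intrinsicInterior hconv
  obtain ⟨p', hp', rfl⟩ := mem_intrinsicInterior.1 hp
  obtain ⟨δ, hδ, hball⟩ := Metric.isOpen_iff.1 isOpen_interior p' hp'
  set p : Fin n → ℝ := (p' : Fin n → ℝ) with hpdef
  have hpF : p ∈ F := intrinsicInterior_subset hp
  -- As `F` spans its hyperplane, a relative interior point has a full neighbourhood within the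
  -- hyperplane.
  have hnear : ∀ q, a ⬝ᵥ q = b → ‖q - p‖ < δ → q ∈ F := by
    intro q hq hqp
    have hd : q - p ∈ vectorSpan ℝ F := by
      refine mem_vectorSpan_of_dotProduct_eq_zero hdim ha hF ?_
      rw [dotProduct_sub, hq, hF p hpF, sub_self]
    have hqs : q ∈ affineSpan ℝ F := by
      have := AffineSubspace.vadd_mem_of_mem_direction (s := affineSpan ℝ F)
        (by rwa [direction_affineSpan]) (mem_affineSpan ℝ hpF)
      rwa [vadd_eq_add, sub_add_cancel] at this
    have : (⟨q, hqs⟩ : affineSpan ℝ F) ∈ interior (((↑) : affineSpan ℝ F → Fin n → ℝ) ⁻¹' F) := by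
      refine hball ?_
      rw [Metric.mem_ball, Subtype.dist_eq, dist_eq_norm]
      exact hqp
    exact Set.mem_preimage.1 (interior_subset this)
  have hpos := dotProduct_self_pos_of_ne_zero ha
  obtain ⟨u, hu⟩ : ∃ u, a ⬝ᵥ u = 1 :=
    ⟨(a ⬝ᵥ a)⁻¹ • a, by rw [dotProduct_smul, smul_eq_mul, inv_mul_cancel₀ hpos.ne']⟩
  obtain ⟨R, hR⟩ := isBounded_iff_forall_norm_le.1 hB
  -- With `t ≤ 2 * ε ≤ 1 / 2`, the point `q` found below is within `2 * ε * M` of `p`, and the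
  -- choice of `ε` makes this less than `δ`.
  set M : ℝ := ‖u‖ + 2 * (|R| + ‖p‖) + 1 with hM
  have hMpos : 0 < M := by positivity
  set ε : ℝ := min (1 / 4) (δ / (4 * M)) with hε
  have hεpos : 0 < ε := lt_min (by norm_num) (by positivity)
  have hε4 : ε ≤ 1 / 4 := min_le_left _ _
  have hεM : ε * M ≤ δ / 4 := by
    have := min_le_right (1 / 4) (δ / (4 * M))
    rw [← hε, le_div_iff₀ (by positivity)] at this
    linarith
  have hax : a ⬝ᵥ (p + ε • u) = b + ε := by
    rw [dotProduct_add, dotProduct_smul, hu, hF p hpF, smul_eq_mul, mul_one]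
  refine ⟨p + ε • u, by rw [hax]; linarith, fun y hy hyb => ?_⟩
  set s : ℝ := a ⬝ᵥ y - b with hs
  have hs2 : 1 / 2 ≤ s := by linarith
  have hspos : 0 < s := by linarith
  -- Heights above the hyperplane are `ε` at the new point and `s` at `y`, which forces the position
  -- on the segment and hence `q`.
  set t : ℝ := ε / s with ht
  have htpos : 0 < t := div_pos hεpos hspos
  have ht2 : t ≤ 2 * ε := by
    rw [ht, div_le_iff₀ hspos]
    nlinarith
  have ht1 : 1 / 2 ≤ 1 - t := by linarith
  have ht1' : (1 - t) ≠ 0 := by linarith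
  have hts : t * s = ε := div_mul_cancel₀ _ hspos.ne'
  have hqp : (1 - t)⁻¹ • (p + ε • u - t • y) - p = (1 - t)⁻¹ • (ε • u - t • (y - p)) := by
    have h1 : p = (1 - t)⁻¹ • ((1 - t) • p) := by rw [smul_smul, inv_mul_cancel₀ ht1', one_smul]
    nth_rewrite 2 [h1]
    rw [← smul_sub]
    congr 1
    module
  refine ⟨(1 - t)⁻¹ • (p + ε • u - t • y), hnear _ ?_ ?_, 1 - t, t, by linarith, htpos.le,
    by ring, ?_⟩
  · rw [dotProduct_smul, dotProduct_sub, hax, dotProduct_smul, smul_eq_mul, smul_eq_mul,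
      inv_mul_eq_iff_eq_mul₀ ht1']
    have : a ⬝ᵥ y = s + b := by rw [hs]; ring
    rw [this]
    linarith
  · rw [hqp, norm_smul, norm_inv, Real.norm_eq_abs, abs_of_pos (by linarith),
      inv_mul_lt_iff₀ (by linarith)]
    have h1 : ‖ε • u - t • (y - p)‖ ≤ ε * ‖u‖ + t * (|R| + ‖p‖) := by
      refine (norm_sub_le _ _).trans ?_
      rw [norm_smul, norm_smul, Real.norm_eq_abs, Real.norm_eq_abs, abs_of_pos hεpos,
        abs_of_pos htpos]
      gcongr
      exact (norm_sub_le _ _).trans (by gcongr; exact (hR y hy).trans (le_abs_self R))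
    have h2 : t * (|R| + ‖p‖) ≤ 2 * ε * (|R| + ‖p‖) := by gcongr
    have h3 : ε * M = ε * ‖u‖ + 2 * ε * (|R| + ‖p‖) + ε := by rw [hM]; ring
    nlinarith
  · rw [smul_smul, mul_inv_cancel₀ ht1', one_smul]
    abel

/-! ### Appending a cut, and the second inequality. -/

theorem labelSet_cons {n : ℕ} (K : Set (Fin n → ℝ)) (L : List (Set (Fin n → ℝ))) :
    labelSet (K :: L) = K ∩ labelSet L := by
  ext x
  simp [labelSet]

theorem convex_labelSet {n : ℕ} {L : List (Set (Fin n → ℝ))} (hL : ∀ K ∈ L, Convex ℝ K) :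
    Convex ℝ (labelSet L) := by
  have : labelSet L = ⋂ K ∈ L, K := by ext x; simp [labelSet]
  rw [this]
  exact convex_iInter₂ hL

/-- A pure cutting plane proof has a single leaf, where one more cut with a trivial certificate can
be appended at the cost of two nodes. -/
theorem exists_leaf_and_append_cut {n : ℕ} {S : ProofSystem n} (T : BCTree n) :
    ∀ L : List (Set (Fin n → ℝ)), (∀ K ∈ L, Convex ℝ K) → IsCuttingPlaneProof S L T →
    ∃ L' : List (Set (Fin n → ℝ)), (∀ K ∈ L', Convex ℝ K) ∧ T.leafUnion L = labelSet L' ∧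
      labelSet L ∩ intLattice n ⊆ labelSet L' ∧ labelSet L' ⊆ labelSet L ∧
      ∀ H G, S.cutting L' H → IsValidHalfspace L' H → Convex ℝ G →
        G ∩ intLattice n = intLattice n \ H → labelSet (G :: L') = ∅ →
        ∃ T' : BCTree n, IsCuttingPlaneProof S L T' ∧ T'.leafUnion L = labelSet (H :: L') ∧
          T'.size = T.size + 2 := by
  induction T with
  | leaf =>
    intro L hL _
    refine ⟨L, hL, rfl, Set.inter_subset_left, subset_rfl, fun H G hcut hval hG hGH hemp => ?_⟩
    -- The old leaf becomes a cut node with a one-leaf certificate and a new leaf: size three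
    -- instead of one.
    exact ⟨.cut H G .leaf .leaf, ⟨trivial, hcut, hval, ⟨hG, hGH⟩, ⟨trivial, hemp⟩, trivial⟩, rfl,
      rfl⟩
  | branch p K T ih => exact fun L hL hT => hT.1.elim
  | cut H₀ G₀ c T _ ih =>
    rintro L hL ⟨hpure, hS, hH, hG, hc, hT⟩
    obtain ⟨L', hconv, hleaf, hint, hsub, happ⟩ := ih (H₀ :: L)
      (List.forall_mem_cons.2 ⟨hH.1.1, hL⟩) ⟨hpure, hT⟩
    rw [labelSet_cons] at hint hsub
    -- Validity of the cut is what keeps the lattice points in the leaf.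
    refine ⟨L', hconv, hleaf, fun x hx => hint ⟨⟨hH.2 hx, hx.1⟩, hx.2⟩,
      hsub.trans Set.inter_subset_right, fun H G h1 h2 h3 h4 h5 => ?_⟩
    obtain ⟨T', ⟨hp, hv⟩, hl, hs⟩ := happ H G h1 h2 h3 h4 h5
    refine ⟨.cut H₀ G₀ c T', ⟨hp, hS, hH, hG, hc, hv⟩, hl, ?_⟩
    simp only [BCTree.size, hs]
    ring
  | cutOther H₀ k T ih =>
    rintro L hL ⟨hpure, hS, hH, hk, hT⟩
    obtain ⟨L', hconv, hleaf, hint, hsub, happ⟩ := ih (H₀ :: L)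
      (List.forall_mem_cons.2 ⟨hH.1.1, hL⟩) ⟨hpure, hT⟩
    rw [labelSet_cons] at hint hsub
    refine ⟨L', hconv, hleaf, fun x hx => hint ⟨⟨hH.2 hx, hx.1⟩, hx.2⟩,
      hsub.trans Set.inter_subset_right, fun H G h1 h2 h3 h4 h5 => ?_⟩
    obtain ⟨T', ⟨hp, hv⟩, hl, hs⟩ := happ H G h1 h2 h3 h4 h5
    refine ⟨.cutOther H₀ k T', ⟨hp, hS, hH, hk, hv⟩, hl, ?_⟩
    simp only [BCTree.size, hs]
    ring

theorem dotProduct_intCast_of_mem_intLattice {n : ℕ} (a : Fin n → ℤ) {x : Fin n → ℝ}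
    (hx : x ∈ intLattice n) : ∃ m : ℤ, (fun j => (a j : ℝ)) ⬝ᵥ x = m := by
  choose z hz using hx
  refine ⟨a ⬝ᵥ z, ?_⟩
  rw [show x = fun j => (z j : ℝ) from funext hz]
  simp [dotProduct]

theorem facetComplexity_le_membershipComplexity_add_two {n : ℕ} (S : ProofSystem n)
    (hCG : S.GeneratesAllCGCuts) (L : List (Set (Fin n → ℝ))) (hconv : ∀ K ∈ L, Convex ℝ K)
    (hbdd : Bornology.IsBounded (labelSet L)) (hfull : affineSpan ℝ (integerHull L) = ⊤) :
    facetComplexity S L ≤ membershipComplexity S L + 2 := by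
  refine iSup₂_le fun F hF => ?_
  obtain ⟨a, b, hprim, ha, hsub, hFeq⟩ := hF.exists_primitive_normal hfull
  have hdim := hF.2.2
  rw [finrank_vectorSpan_of_affineSpan_eq_top hfull] at hdim
  set a' : Fin n → ℝ := fun j => (a j : ℝ) with ha'
  have hFconv : Convex ℝ F := by
    rw [hFeq]
    exact (convex_convexHull ℝ _).inter (convex_hyperplane (dotFunctional a').isLinear _)
  obtain ⟨x, hxb, hx⟩ := exists_point_beyond_facet hFconv hF.2.1 hdim ha
    (fun y hy => (hFeq ▸ hy : y ∈ integerHull L ∩ _).2) hbdd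
  have hxQ : x ∉ integerHull L := fun h => absurd (hsub h) (not_le.2 hxb)
  refine (iInf₂_le (closedHalfspace a' b) ⟨a', b, ha, rfl, hsub, hFeq⟩).trans ?_
  refine le_trans ?_ (add_le_add_left (le_iSup₂ (f := fun x _ => pointComplexity S L x) x hxQ) 2)
  rw [pointComplexity, ENat.iInf_add]
  refine le_iInf fun T => ?_
  rw [ENat.iInf_add]
  refine le_iInf fun hT => ?_
  obtain ⟨L', hL', hleaf, hint, hLL', happ⟩ := exists_leaf_and_append_cut T L hconv hT.1
  have hxL' : x ∉ labelSet L' := fun h => hT.2 (subset_convexHull ℝ _ (hleaf ▸ h))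
  have hhull : integerHull L ⊆ labelSet L' := convexHull_min hint (convex_labelSet hL')
  -- A leaf point at height `b + 1/2` would, with a point of `F`, trap `x` in the convex leaf set.
  have hlt : ∀ y ∈ labelSet L', a' ⬝ᵥ y < b + 1 / 2 := by
    intro y hy
    by_contra! h
    obtain ⟨q, hq, hxs⟩ := hx y (hLL' hy) h
    exact hxL' ((convex_labelSet hL').segment_subset
      (hhull (hFeq ▸ hq : q ∈ integerHull L ∩ _).1) hy hxs)
  -- The right-hand side `b + 1/2` is rational and rounds down to `b`.
  have hcg := convexHull_closedHalfspace_inter_intLattice (b := b) (β := b + 1 / 2)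
    (by linarith) (by linarith) hprim
  have hcut : S.cutting L' (closedHalfspace a' b) := by
    rw [← hcg]
    refine hCG L' hL' _ ⟨fun j => (a j : ℚ), (b : ℚ) + 1 / 2, ?_, ?_⟩ fun y hy => (hlt y hy).le
    · intro h
      refine ha (funext fun j => ?_)
      have := congrFun h j
      simpa [ha'] using this
    · simp
  have hvalid : IsValidHalfspace L' (closedHalfspace a' b) := by
    refine ⟨⟨convex_closedHalfspace _ _, ?_⟩, fun y hy => ?_⟩
    · have : (closedHalfspace a' b)ᶜ = {y | (b : ℝ) < a' ⬝ᵥ y} := by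
        ext y
        simp [closedHalfspace]
      rw [this]
      exact convex_halfSpace_gt (dotFunctional a').isLinear _
    · rw [← hcg]
      exact subset_convexHull ℝ _ ⟨(hlt y hy.1).le, hy.2⟩
  -- By integrality, lattice points violating the cut have height at least `b + 1`, a region the
  -- leaf set does not reach; the certificate is therefore one empty leaf.
  obtain ⟨T', hT', hl, hs⟩ := happ _ {y | (b : ℝ) + 1 ≤ a' ⬝ᵥ y} hcut hvalid
    (convex_halfSpace_ge (dotFunctional a').isLinear _)
    (by
      ext y
      constructor
      · rintro ⟨hy, hyz⟩
        refine ⟨hyz, fun h => ?_⟩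
        have h1 : (b : ℝ) + 1 ≤ a' ⬝ᵥ y := hy
        have h2 : a' ⬝ᵥ y ≤ b := h
        linarith
      · rintro ⟨hyz, hy⟩
        refine ⟨?_, hyz⟩
        obtain ⟨m, hm⟩ := dotProduct_intCast_of_mem_intLattice a hyz
        have h2 : (b : ℝ) < m := hm ▸ not_le.1 hy
        change (b : ℝ) + 1 ≤ a' ⬝ᵥ y
        rw [hm]
        exact_mod_cast Int.add_one_le_iff.2 (by exact_mod_cast h2))
    (by
      rw [labelSet_cons, Set.eq_empty_iff_forall_notMem]
      rintro y ⟨hy, hyL⟩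
      have h1 : (b : ℝ) + 1 ≤ a' ⬝ᵥ y := hy
      linarith [hlt y hyL])
  refine (iInf₂_le T' ⟨hT', ?_⟩).trans ?_
  · rw [hs]
    push_cast
    exact le_rfl
  · rw [hl, labelSet_cons]
    exact Set.inter_subset_left

theorem mainTheorem6 (n : ℕ) (S : ProofSystem n) (hCG : S.GeneratesAllCGCuts)
    (L : List (Set (Fin n → ℝ))) (hconv : ∀ K ∈ L, Convex ℝ K)
    (hpoly : IsPolyhedron (labelSet L)) (hrec : IsRationalCone (recCone (labelSet L)))
    (hfull : affineSpan ℝ (integerHull L) = ⊤) (hrat : IsRationalPolytope (integerHull L)) :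
    membershipComplexity S L ≤ facetComplexity S L ∧
      facetComplexity S L ≤ membershipComplexity S L + 2 := by
  refine ⟨membershipComplexity_le_facetComplexity S L hfull hrat, ?_⟩
  have hbddI : Bornology.IsBounded (integerHull L) := by
    obtain ⟨V, hV, -, hVL⟩ := hrat
    rw [hVL]
    exact (hV.isCompact_convexHull ℝ).isBounded
  -- Full-dimensionality supplies the lattice point needed in the boundedness argument.
  have hne : (labelSet L ∩ intLattice n).Nonempty := by
    rw [← convexHull_nonempty_iff (𝕜 := ℝ)]
    change (integerHull L).Nonempty
    rw [← affineSpan_nonempty ℝ, hfull]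
    exact Set.univ_nonempty
  exact facetComplexity_le_membershipComplexity_add_two S hCG L hconv
    (isBounded_of_isBounded_integerHull hpoly hrec hne hbddI) hfull
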